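/- Let $(M,d)$ be a metric space with a chosen base point $0_M\in M$. Let $\mathrm{Lip}_0(M)$ be the Banach space of all Lipschitz functions $f:M\to\mathbb{R}$ with $f(0_M)=0$, with norm $\|f\|_{Lip}=\sup_{x\ne y}\frac{|f(x)-f(y)|}{d(x,y)}$ (equal to $0$ if $M$ is a single point), and let the Lipschitz-free space $\mathcal{F}(M)$ be the norm closure in $\mathrm{Lip}_0(M)^*$ of the linear span of the evaluation functionals $\delta_x:f\mapsto f(x)$, $x\in M$. Two metric spaces are Lipschitz equivalent if there is a bijection between them which is Lipschitz and has Lipschitz inverse. A subset $F\subseteq M$, with the induced metric, is a Lipschitz retract of $M$ if there is a Lipschitz map from $M$ onto $F$ which is the identity on $F$. **Corollary 3.2** (a nonlinear Pełczyński decomposition for free spaces). Let $X$ be a real Banach space and $M$ a metric space. Suppose that there are a Lipschitz retract $N_1$ of $X$ and a Lipschitz retract $N_2$ of $M$ such that $X$ is Lipschitz equivalent to $N_2$ and $M$ is Lipschitz equivalent to $N_1$. Then, for every choice of base points in $X$ and $M$, the Banach spaces $\mathcal{F}(X)$ and $\mathcal{F}(M)$ are isomorphic, that is, there is a linear homeomorphism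 of $\mathcal{F}(X)$ onto $\mathcal{F}(M)$. -/

import Mathlib

open scoped NNReal

noncomputable section

namespace LipFree

/-- The real vector space of real-valued Lipschitz functions on `M` vanishing at the base
point `x₀`. -/
def lipSubmodule {M : Type*} [MetricSpace M] (x₀ : M) : Submodule ℝ (M → ℝ) where
  carrier := {f | (∃ K : ℝ≥0, LipschitzWith K f) ∧ f x₀ = 0}
  zero_mem' := ⟨⟨0, LipschitzWith.const 0⟩, rfl⟩
  add_mem' := by
    rintro f g ⟨⟨K, hK⟩, hf⟩ ⟨⟨L, hL⟩, hg⟩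
    exact ⟨⟨K + L, hK.add hL⟩, by simp [hf, hg]⟩
  smul_mem' := by
    rintro c f ⟨⟨K, hK⟩, hf⟩
    refine ⟨⟨‖c‖₊ * K, ?_⟩, by simp [hf]⟩
    refine LipschitzWith.of_dist_le_mul fun x y => ?_
    have h := hK.dist_le_mul x y
    rw [Real.dist_eq] at h ⊢
    simp only [Pi.smul_apply, smul_eq_mul, NNReal.coe_mul, coe_nnnorm, Real.norm_eq_abs]
    rw [← mul_sub, abs_mul, mul_assoc]
    exact mul_le_mul_of_nonneg_left h (abs_nonneg c)

/-- `Lip₀(M)`, as a type of its own (so that no norm is inherited from `M → ℝ`). -/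
def Lip0 {M : Type*} [MetricSpace M] (x₀ : M) : Type _ := lipSubmodule x₀

section

variable {M : Type*} [MetricSpace M] {x₀ : M}

instance : AddCommGroup (Lip0 x₀) := inferInstanceAs (AddCommGroup (lipSubmodule x₀))

instance : Module ℝ (Lip0 x₀) := inferInstanceAs (Module ℝ (lipSubmodule x₀))

instance : CoeFun (Lip0 x₀) (fun _ => M → ℝ) := ⟨fun f => f.1⟩

/-- The Lipschitz norm `sup_{x ≠ y} |f x - f y| / d(x, y)`; pairs with `x = y` contribute `0`. -/
instance : Norm (Lip0 x₀) := ⟨fun f => ⨆ p : M × M, |f p.1 - f p.2| / dist p.1 p.2⟩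

theorem Lip0.norm_def (f : Lip0 x₀) :
    ‖f‖ = ⨆ p : M × M, |f p.1 - f p.2| / dist p.1 p.2 := rfl

theorem Lip0.add_apply (f g : Lip0 x₀) (x : M) : (f + g) x = f x + g x := rfl

theorem Lip0.smul_apply (c : ℝ) (f : Lip0 x₀) (x : M) : (c • f) x = c * f x := rfl

theorem Lip0.base_apply (f : Lip0 x₀) : f x₀ = 0 := f.2.2

theorem Lip0.bddAbove (f : Lip0 x₀) :
    BddAbove (Set.range fun p : M × M => |f p.1 - f p.2| / dist p.1 p.2) := by
  obtain ⟨K, hK⟩ := f.2.1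
  refine ⟨K, ?_⟩
  rintro _ ⟨p, rfl⟩
  have h := hK.dist_le_mul p.1 p.2
  rw [Real.dist_eq] at h
  exact div_le_of_le_mul₀ dist_nonneg K.2 h

theorem Lip0.abs_sub_le (f : Lip0 x₀) (x y : M) : |f x - f y| ≤ ‖f‖ * dist x y := by
  rcases eq_or_ne x y with rfl | h
  · simp
  · have h' : |f x - f y| / dist x y ≤ ‖f‖ := le_ciSup f.bddAbove (x, y)
    rwa [div_le_iff₀ (dist_pos.2 h)] at h'

theorem Lip0.norm_nonneg' (f : Lip0 x₀) : 0 ≤ ‖f‖ :=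
  Real.iSup_nonneg fun _ => div_nonneg (abs_nonneg _) dist_nonneg

theorem Lip0.norm_le_of (f : Lip0 x₀) {C : ℝ} (hC : 0 ≤ C)
    (h : ∀ x y, |f x - f y| ≤ C * dist x y) : ‖f‖ ≤ C :=
  Real.iSup_le (fun p => div_le_of_le_mul₀ dist_nonneg hC (h p.1 p.2)) hC

theorem Lip0.normCore : NormedSpace.Core ℝ (Lip0 x₀) where
  norm_nonneg := Lip0.norm_nonneg'
  norm_smul c f := by
    rw [Lip0.norm_def, Lip0.norm_def, Real.norm_eq_abs, Real.mul_iSup_of_nonneg (abs_nonneg c)]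
    congr 1
    ext p
    rw [Lip0.smul_apply, Lip0.smul_apply, ← mul_sub, abs_mul, mul_div_assoc]
  norm_triangle f g := by
    refine Lip0.norm_le_of _ (add_nonneg f.norm_nonneg' g.norm_nonneg') fun x y => ?_
    rw [Lip0.add_apply, Lip0.add_apply, add_sub_add_comm, add_mul]
    exact (abs_add_le _ _).trans (add_le_add (f.abs_sub_le x y) (g.abs_sub_le x y))
  norm_eq_zero_iff f := by
    constructor
    · intro h
      refine Subtype.ext (funext fun x => ?_)
      have h' := f.abs_sub_le x x₀
      rw [h, zero_mul, f.base_apply, sub_zero] at h'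
      exact abs_nonpos_iff.1 h'
    · rintro rfl
      refine le_antisymm (Lip0.norm_le_of _ le_rfl fun x y => ?_) (Lip0.norm_nonneg' _)
      change |(0 : ℝ) - 0| ≤ _
      simp

instance : NormedAddCommGroup (Lip0 x₀) := NormedAddCommGroup.ofCore Lip0.normCore

instance : NormedSpace ℝ (Lip0 x₀) := NormedSpace.ofCore Lip0.normCore

end

/-- The evaluation functional `δ_x : f ↦ f x` in the dual of `Lip₀(M)`. -/
def delta {M : Type*} [MetricSpace M] (x₀ x : M) : StrongDual ℝ (Lip0 x₀) :=
  LinearMap.mkContinuous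
    { toFun := fun f => f x
      map_add' := fun _ _ => rfl
      map_smul' := fun _ _ => rfl } (dist x x₀) (by
    intro f
    have h := f.abs_sub_le x x₀
    rw [f.base_apply, sub_zero, mul_comm] at h
    exact h)

theorem delta_apply {M : Type*} [MetricSpace M] (x₀ x : M) (f : Lip0 x₀) :
    delta x₀ x f = f x := rfl

/-- The Lipschitz-free space `F(M)` of `M` with base point `x₀`: the norm closure of the span
of the evaluation functionals in the dual of `Lip₀(M)`, with the dual norm. -/
abbrev FreeSpace (M : Type*) [MetricSpace M] (x₀ : M) :
    Submodule ℝ (StrongDual ℝ (Lip0 x₀)) :=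
  (Submodule.span ℝ (Set.range (delta x₀))).topologicalClosure

/-- Two metric spaces are Lipschitz equivalent: there is a bijection between them that is
Lipschitz with Lipschitz inverse. -/
def LipschitzEquivalent (M N : Type*) [MetricSpace M] [MetricSpace N] : Prop :=
  ∃ φ : M ≃ N, (∃ K : ℝ≥0, LipschitzWith K φ) ∧ ∃ K : ℝ≥0, LipschitzWith K φ.symm

/-- `F` is a Lipschitz retract of `M`: some Lipschitz map from `M` onto `F` is the identity
on `F`. -/
def IsLipschitzRetract {M : Type*} [MetricSpace M] (F : Set M) : Prop :=
  ∃ r : M → F, (∃ K : ℝ≥0, LipschitzWith K r) ∧ ∀ x : F, r x = x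

end LipFree

end

open scoped NNReal

noncomputable section

namespace LipFree

/-! The argument is Pełczyński's decomposition method for `E = F(X)`. A Lipschitz map between metric
spaces linearizes to a bounded operator between free spaces, so a Lipschitz retraction becomes a
linear projection. Hence each of `F(X)`, `F(M)` is complemented in the other
(`IsComplementedIn.of_lipschitz_retraction`).

The geometric input is that `ℓ¹(F(X))` is complemented in `F(X)` (`isComplementedIn_l1Sum_free`). A
dyadic partition of unity splits each copy of `X` into annuli, which are shrunk into unit balls
around well separated points. Free spaces scale linearly, so all these maps have uniform Lipschitz
bounds although the radii are unbounded.

Both `F(X)` and `F(M)` are then complemented in `E` and contain `ℓ¹(E)` complemented, so each is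
isomorphic to `ℓ¹(E)` (`IsComplementedIn.nonempty_equiv_l1Sum`). -/

/-- `B` is isomorphic to a complemented subspace of `A`. -/
def IsComplementedIn (B A : Type*) [NormedAddCommGroup B] [NormedSpace ℝ B]
    [NormedAddCommGroup A] [NormedSpace ℝ A] : Prop :=
  ∃ (i : B →L[ℝ] A) (p : A →L[ℝ] B), ∀ b, p (i b) = b

/-- The `ℓ¹`-sum of countably many copies of `E`. -/
abbrev L1Sum (E : Type*) [NormedAddCommGroup E] := lp (fun _ : ℕ => E) 1

theorem L1Sum.hasSum_norm {E : Type*} [NormedAddCommGroup E] (x : L1Sum E) :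
    HasSum (fun n => ‖x n‖) ‖x‖ := by
  simpa using lp.hasSum_norm (p := 1) (by simp) x

/-! ### Complemented subspaces and `ℓ¹`-sums -/

section Abstract

variable {A B E Z : Type*} [NormedAddCommGroup A] [NormedSpace ℝ A]
  [NormedAddCommGroup B] [NormedSpace ℝ B]
  [NormedAddCommGroup E] [NormedSpace ℝ E] [NormedAddCommGroup Z] [NormedSpace ℝ Z]

theorem IsComplementedIn.trans (h : IsComplementedIn A B) (h' : IsComplementedIn B Z) :
    IsComplementedIn A Z := by
  obtain ⟨i, p, hip⟩ := h
  obtain ⟨j, q, hjq⟩ := h'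
  exact ⟨j.comp i, p.comp q, fun b => by simp [hip, hjq]⟩

theorem IsComplementedIn.exists_prod (h : IsComplementedIn A B) :
    ∃ D : Submodule ℝ B, Nonempty (B ≃L[ℝ] A × D) := by
  obtain ⟨i, p, hip⟩ := h
  exact ⟨_, ⟨ContinuousLinearEquiv.equivOfRightInverse p i hip⟩⟩

/-- The embedding of `E` as the `n`-th summand of its `ℓ¹`-sum. -/
def L1Sum.single (n : ℕ) : E →L[ℝ] L1Sum E :=
  lp.singleContinuousLinearMap ℝ (fun _ : ℕ => E) 1 n

theorem L1Sum.norm_single (n : ℕ) (x : E) : ‖L1Sum.single n x‖ = ‖x‖ :=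
  lp.norm_single (E := fun _ : ℕ => E) one_pos n x

theorem L1Sum.hom_ext {S T : L1Sum E →L[ℝ] Z}
    (h : ∀ n x, S (L1Sum.single n x) = T (L1Sum.single n x)) : S = T :=
  lp.ext_continuousLinearMap ENNReal.one_ne_top fun n => ContinuousLinearMap.ext (h n)

theorem L1Sum.exists_lift [CompleteSpace Z] (T : ℕ → E →L[ℝ] Z) {C : ℝ}
    (hT : ∀ n x, ‖T n x‖ ≤ C * ‖x‖) :
    ∃ S : L1Sum E →L[ℝ] Z, ∀ n x, S (L1Sum.single n x) = T n x := by
  have hs (x : L1Sum E) : Summable fun n => C * ‖x n‖ := (hasSum_norm x).summable.mul_left C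
  have hs' (x : L1Sum E) : Summable fun n => T n (x n) :=
    (hs x).of_norm_bounded fun n => hT n (x n)
  refine ⟨LinearMap.mkContinuous
    { toFun := fun x => ∑' n, T n (x n)
      map_add' := fun x y => by
        rw [← (hs' x).tsum_add (hs' y)]
        simp
      map_smul' := fun c x => by
        simp [(hs' x).tsum_const_smul c] } C fun x => ?_, fun n x => ?_⟩
  · have h := tsum_of_norm_bounded ((hasSum_norm x).mul_left C) fun n => hT n (x n)
    exact h
  · change ∑' m, T m ((lp.single 1 n x : L1Sum E) m) = _
    rw [tsum_eq_single n fun m hm => by rw [lp.single_apply_ne _ _ _ hm, map_zero],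
      lp.single_apply_self]

/-- Eilenberg's swindle: a complemented subspace of `E` is absorbed by the `ℓ¹`-sum of `E`. -/
theorem IsComplementedIn.nonempty_l1Sum_prod [CompleteSpace E] [CompleteSpace B]
    (h : IsComplementedIn B E) : Nonempty ((L1Sum E × B) ≃L[ℝ] L1Sum E) := by
  obtain ⟨i, p, hip⟩ := h
  let e : E →L[ℝ] E := i.comp p
  let q : E →L[ℝ] E := ContinuousLinearMap.id ℝ E - e
  have he (x : E) : e x = i (p x) := rfl
  have hq (x : E) : q x = x - i (p x) := rfl
  have hnorm (n m : ℕ) (x : E) :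
      ‖L1Sum.single n (q x) + L1Sum.single m (e x)‖ ≤ (‖q‖ + ‖e‖) * ‖x‖ := by
    refine (norm_add_le _ _).trans ?_
    rw [L1Sum.norm_single, L1Sum.norm_single, add_mul]
    exact add_le_add (q.le_opNorm x) (e.le_opNorm x)
  -- Split `E` as `ker p ⊕ i(B)`. `R` fixes the kernel parts and shifts the `B`-parts one copy to
  -- the right, freeing the `B`-slot of copy `0`. `S` shifts back, dropping that slot, and `P` reads
  -- it.
  obtain ⟨R, hR⟩ := L1Sum.exists_lift
    (fun n => (L1Sum.single n).comp q + (L1Sum.single (n + 1)).comp e) fun n => hnorm n (n + 1)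
  obtain ⟨S, hS⟩ := L1Sum.exists_lift (C := ‖q‖ + ‖e‖)
    (fun n => (L1Sum.single n).comp q + if n = 0 then 0 else (L1Sum.single (n - 1)).comp e) (by
      intro n x
      rcases eq_or_ne n 0 with rfl | hn
      · simpa [L1Sum.norm_single] using (q.le_opNorm x).trans
          (mul_le_mul_of_nonneg_right (le_add_of_nonneg_right (norm_nonneg e)) (norm_nonneg x))
      · simpa [hn] using hnorm n (n - 1) x)
  obtain ⟨P, hP⟩ := L1Sum.exists_lift (E := E) (C := ‖p‖) (fun n => if n = 0 then p else 0) (by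
    intro n x
    rcases eq_or_ne n 0 with rfl | hn
    · simpa using p.le_opNorm x
    · simpa [hn] using mul_nonneg (norm_nonneg p) (norm_nonneg x))
  have hR' (n : ℕ) (x : E) : R (L1Sum.single n x) =
      L1Sum.single n (x - i (p x)) + L1Sum.single (n + 1) (i (p x)) := hR n x
  have hS0 (x : E) : S (L1Sum.single 0 x) = L1Sum.single 0 (x - i (p x)) := by
    simp [hS, hq]
  have hS' (n : ℕ) (x : E) : S (L1Sum.single (n + 1) x) =
      L1Sum.single (n + 1) (x - i (p x)) + L1Sum.single n (i (p x)) := by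
    simp [hS, hq, he]
  have hP0 (x : E) : P (L1Sum.single 0 x) = p x := by simp [hP]
  have hP' (n : ℕ) (x : E) : P (L1Sum.single (n + 1) x) = 0 := by simp [hP]
  have hSR : S.comp R = ContinuousLinearMap.id ℝ _ := by
    refine L1Sum.hom_ext fun n x => ?_
    rcases n with _ | n
    · simp [hR', hS0, hS', hip]
    · simp [hR', hS', hip]
  have hPR : P.comp R = 0 := by
    refine L1Sum.hom_ext fun n x => ?_
    rcases n with _ | n
    · simp [hR', hP0, hP', hip]
    · simp [hR', hP']
  have hRS : R.comp S + ((L1Sum.single 0).comp i).comp P = ContinuousLinearMap.id ℝ _ := by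
    refine L1Sum.hom_ext fun n x => ?_
    rcases n with _ | n
    · simp [hR', hS0, hP0, hip]
    · simp [hR', hS', hP', hip]
  refine ⟨ContinuousLinearEquiv.equivOfInverse (R.coprod ((L1Sum.single 0).comp i)) (S.prod P)
    ?_ ?_⟩
  · rintro ⟨a, b⟩
    have h1 : S (R a) = a := DFunLike.congr_fun hSR a
    have h2 : P (R a) = 0 := DFunLike.congr_fun hPR a
    simp [h1, h2, hS0, hP0, hip]
  · intro a
    exact DFunLike.congr_fun hRS a

/-- Pełczyński decomposition: if the `ℓ¹`-sum of `E` embeds as a complemented subspace into a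
complemented subspace `B` of `E`, then `B` is isomorphic to the `ℓ¹`-sum of `E`. -/
theorem IsComplementedIn.nonempty_equiv_l1Sum [CompleteSpace E] [CompleteSpace B]
    (h : IsComplementedIn B E) (h' : IsComplementedIn (L1Sum E) B) :
    Nonempty (B ≃L[ℝ] L1Sum E) := by
  obtain ⟨e₁⟩ := h.nonempty_l1Sum_prod
  obtain ⟨e₂⟩ := (h'.trans h).nonempty_l1Sum_prod
  obtain ⟨D, ⟨e₃⟩⟩ := h'.exists_prod
  let eD := ContinuousLinearEquiv.refl ℝ D
  let eA := ContinuousLinearEquiv.refl ℝ (L1Sum E)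
  -- With `A = ℓ¹(E)`: `B ≅ A × D ≅ (A × A) × D ≅ A × (A × D) ≅ A × B ≅ A`.
  exact ⟨e₃.trans <| (e₂.symm.prodCongr eD).trans <|
    (ContinuousLinearEquiv.prodAssoc ℝ _ _ _).trans <| (eA.prodCongr e₃.symm).trans e₁⟩

end Abstract

/-! ### Free spaces and linearization of Lipschitz maps -/

section Free

variable {M E W Z : Type*} [NormedAddCommGroup E] [NormedSpace ℝ E]
  [NormedAddCommGroup W] [NormedSpace ℝ W] [NormedAddCommGroup Z] [NormedSpace ℝ Z]

/-- The closed linear span of a family of vectors. -/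
abbrev closedSpan (d : M → E) : Submodule ℝ E :=
  (Submodule.span ℝ (Set.range d)).topologicalClosure

theorem closedSpan_le {d : M → E} {V : Submodule ℝ E} (hV : IsClosed (V : Set E))
    (h : ∀ x, d x ∈ V) : closedSpan d ≤ V :=
  Submodule.topologicalClosure_minimal _ (Submodule.span_le.2 (Set.range_subset_iff.2 h)) hV

theorem mem_closedSpan (d : M → E) (x : M) : d x ∈ closedSpan d :=
  Submodule.le_topologicalClosure _ (Submodule.subset_span ⟨x, rfl⟩)

theorem closedSpan_hom_ext {d : M → E} {S T : closedSpan d →L[ℝ] Z}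
    (h : ∀ x, S ⟨d x, mem_closedSpan d x⟩ = T ⟨d x, mem_closedSpan d x⟩) : S = T := by
  have hc : IsClosed (closedSpan d : Set E) := Submodule.isClosed_topologicalClosure _
  have hK : IsClosed ((S - T).ker : Set (closedSpan d)) := (S - T).isClosed_ker
  have hV : closedSpan d ≤ (S - T).ker.map (closedSpan d).subtype := by
    refine closedSpan_le ?_ fun x => ⟨⟨d x, mem_closedSpan d x⟩, by simp [h x], rfl⟩
    rw [Submodule.map_coe]
    exact hc.isClosedEmbedding_subtypeVal.isClosedMap _ hK
  refine ContinuousLinearMap.ext fun μ => ?_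
  obtain ⟨ν, hν, hνμ⟩ := hV μ.2
  have : ν = μ := Subtype.ext hνμ
  subst this
  exact sub_eq_zero.1 hν

/-- Completeness of `Z` makes the range of `J` closed, so `R` maps the whole closed span into it and
`T` is `J⁻¹ ∘ R`. -/
theorem closedSpan_exists_lift [CompleteSpace Z] {d : M → E} {u : M → Z} (J : Z →ₗᵢ[ℝ] W)
    (R : E →L[ℝ] W) (hR : ∀ x, J (u x) = R (d x)) :
    ∃ T : closedSpan d →L[ℝ] Z, (∀ x, T ⟨d x, mem_closedSpan d x⟩ = u x) ∧
      ∀ μ, J (T μ) = R μ := by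
  have hJ : IsClosed (J.range : Set W) :=
    J.isometry.isUniformInducing.isComplete_range.isClosed
  have hV : closedSpan d ≤ J.range.comap R.toLinearMap :=
    closedSpan_le (hJ.preimage R.continuous) fun x => ⟨_, hR x⟩
  let T₀ : closedSpan d →L[ℝ] J.range :=
    (R.comp (closedSpan d).subtypeL).codRestrict J.range fun μ => hV μ.2
  refine ⟨(J.equivRange.symm.toContinuousLinearEquiv : J.range →L[ℝ] Z).comp T₀, fun x => ?_,
    fun μ => ?_⟩
  swap
  · exact congrArg Subtype.val (J.equivRange.apply_symm_apply (T₀ μ))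
  change J.equivRange.symm (T₀ ⟨d x, _⟩) = _
  rw [LinearIsometryEquiv.symm_apply_eq]
  exact Subtype.ext (hR x).symm

/-- The adjoint of `R` maps into the bidual of `Z` and sends each `d x` to the canonical image of `u
x`, hence it carries the closed span into `Z` itself. -/
theorem dual_closedSpan_exists_lift [CompleteSpace Z] {d : M → StrongDual ℝ E} {u : M → Z}
    (R : StrongDual ℝ Z →L[ℝ] E) (hR : ∀ g x, d x (R g) = g (u x)) :
    ∃ T : closedSpan d →L[ℝ] Z, (∀ x, T ⟨d x, mem_closedSpan d x⟩ = u x) ∧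
      ∀ μ, ‖T μ‖ ≤ ‖R‖ * ‖μ‖ := by
  obtain ⟨T, hT, hT'⟩ := closedSpan_exists_lift (E := StrongDual ℝ E) (d := d) (u := u)
    (W := StrongDual ℝ (StrongDual ℝ Z))
    (NormedSpace.inclusionInDoubleDualLi ℝ)
    ((ContinuousLinearMap.compL ℝ (StrongDual ℝ Z) E ℝ).flip R)
    fun x => ContinuousLinearMap.ext fun g => (hR g x).symm
  refine ⟨T, hT, fun μ => ?_⟩
  rw [← (NormedSpace.inclusionInDoubleDualLi (E := Z) ℝ).norm_map, hT', mul_comm]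
  exact ContinuousLinearMap.opNorm_comp_le (μ : StrongDual ℝ E) R

variable [MetricSpace M] {x₀ : M}

/-- The Lipschitz-free space as a Banach space in its own right. -/
def Free (x₀ : M) : Type _ := closedSpan (E := StrongDual ℝ (Lip0 x₀)) (delta x₀)

instance : NormedAddCommGroup (Free x₀) :=
  inferInstanceAs (NormedAddCommGroup (closedSpan (E := StrongDual ℝ (Lip0 x₀)) (delta x₀)))

instance : NormedSpace ℝ (Free x₀) :=
  inferInstanceAs (NormedSpace ℝ (closedSpan (E := StrongDual ℝ (Lip0 x₀)) (delta x₀)))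

instance : CompleteSpace (Free x₀) :=
  (Submodule.isClosed_topologicalClosure (Submodule.span ℝ (Set.range (delta x₀)) :
    Submodule ℝ (StrongDual ℝ (Lip0 x₀)))).completeSpace_coe

/-- `Free x₀` is the Lipschitz-free space. -/
def freeEquiv (x₀ : M) : Free x₀ ≃L[ℝ] FreeSpace M x₀ :=
  ContinuousLinearEquiv.refl ℝ (FreeSpace M x₀)

/-- The canonical map of `M` into its Lipschitz-free space. -/
def freeDelta (x₀ x : M) : Free x₀ :=
  ⟨delta x₀ x, mem_closedSpan (E := StrongDual ℝ (Lip0 x₀)) (delta x₀) x⟩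

theorem freeDelta_base : freeDelta x₀ x₀ = 0 :=
  Subtype.ext (ContinuousLinearMap.ext fun f => f.base_apply)

theorem lipschitzWith_freeDelta (x₀ : M) : LipschitzWith 1 (freeDelta x₀) := by
  refine LipschitzWith.of_dist_le_mul fun x y => ?_
  rw [dist_eq_norm, NNReal.coe_one, one_mul]
  refine ContinuousLinearMap.opNorm_le_bound (E := Lip0 x₀) (delta x₀ x - delta x₀ y)
    dist_nonneg fun f => ?_
  rw [mul_comm]
  exact f.abs_sub_le x y

theorem Free.hom_ext {S T : Free x₀ →L[ℝ] Z}
    (h : ∀ x, S (freeDelta x₀ x) = T (freeDelta x₀ x)) : S = T :=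
  closedSpan_hom_ext (E := StrongDual ℝ (Lip0 x₀)) (d := delta x₀) h

/-- Composition of functionals with a Lipschitz map, normalized at the base point. -/
theorem exists_pullback (x₀ : M) {f : M → Z} {K : ℝ≥0} (hf : LipschitzWith K f) :
    ∃ R : StrongDual ℝ Z →L[ℝ] Lip0 x₀, (∀ g x, R g x = g (f x - f x₀)) ∧ ‖R‖ ≤ K := by
  have hLip (g : StrongDual ℝ Z) (x y : M) :
      |g (f x - f x₀) - g (f y - f x₀)| ≤ K * ‖g‖ * dist x y := by
    rw [← map_sub, sub_sub_sub_cancel_right, ← Real.norm_eq_abs]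
    refine (g.le_opNorm _).trans ?_
    rw [← dist_eq_norm, mul_comm (K : ℝ), mul_assoc]
    exact mul_le_mul_of_nonneg_left (hf.dist_le_mul x y) (norm_nonneg g)
  refine ⟨LinearMap.mkContinuous (F := Lip0 x₀)
    { toFun := fun g => (⟨fun x => g (f x - f x₀), ⟨K * ‖g‖₊, LipschitzWith.of_dist_le_mul
        fun x y => hLip g x y⟩, by simp⟩ : lipSubmodule x₀)
      map_add' := fun g g' => rfl
      map_smul' := fun c g => rfl } K fun g => ?_, fun g x => rfl,
    LinearMap.mkContinuous_norm_le _ K.2 _⟩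
  exact Lip0.norm_le_of _ (by positivity) (hLip g)

/-- The universal property of the Lipschitz-free space. -/
theorem Free.exists_lift [CompleteSpace Z] (x₀ : M) {f : M → Z} {K : ℝ≥0}
    (hf : LipschitzWith K f) :
    ∃ T : Free x₀ →L[ℝ] Z, (∀ x, T (freeDelta x₀ x) = f x - f x₀) ∧
      ∀ μ, ‖T μ‖ ≤ K * ‖μ‖ := by
  obtain ⟨R, hR, hRK⟩ := exists_pullback x₀ hf
  obtain ⟨T, hT, hT'⟩ := dual_closedSpan_exists_lift (E := Lip0 x₀) (d := delta x₀) R hR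
  exact ⟨T, hT, fun μ => (hT' μ).trans (mul_le_mul_of_nonneg_right hRK (norm_nonneg μ))⟩

/-- The maps need not preserve base points: the correction terms cancel in `P ∘ I`, leaving `δ_x -
δ_{n₀} = δ_x`. Identity maps thus give a change of base point. -/
theorem IsComplementedIn.of_lipschitz_retraction {N : Type*} [MetricSpace N] (n₀ : N) (m₀ : M)
    {j : N → M} {r : M → N} {K C : ℝ≥0} (hj : LipschitzWith K j) (hr : LipschitzWith C r)
    (h : ∀ x, r (j x) = x) : IsComplementedIn (Free n₀) (Free m₀) := by
  obtain ⟨I, hI, -⟩ := Free.exists_lift n₀ ((lipschitzWith_freeDelta m₀).comp hj)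
  obtain ⟨P, hP, -⟩ := Free.exists_lift m₀ ((lipschitzWith_freeDelta n₀).comp hr)
  have : P.comp I = ContinuousLinearMap.id ℝ _ := Free.hom_ext fun x => by
    simp [hI, hP, h, freeDelta_base]
  exact ⟨I, P, fun b => DFunLike.congr_fun this b⟩

end Free

end LipFree

end

noncomputable section

namespace LipFree

/-! ### Embedding `ℓ¹(F(X))` as a complemented subspace of `F(X)` -/

section Geometry

/-- A sum of uniformly Lipschitz maps, at most `m` of which are nonzero at each point, is
Lipschitz. -/
theorem lipschitzWith_finsum {ι X Z : Type*} [MetricSpace X] [NormedAddCommGroup Z]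
    {f : ι → X → Z} {K : ℝ≥0} (m : ℕ) (hK : ∀ i x y, ‖f i x - f i y‖ ≤ K * dist x y)
    (hS : ∀ x, ∃ S : Finset ι, S.card ≤ m ∧ ∀ i ∉ S, f i x = 0) :
    LipschitzWith ((2 * m : ℕ) * K) fun x => ∑ᶠ i, f i x := by
  classical
  choose S hc h0 using hS
  have hsum (x : X) (T : Finset ι) (hT : S x ⊆ T) : ∑ᶠ i, f i x = ∑ i ∈ T, f i x := by
    refine finsum_eq_sum_of_support_subset _ fun i hi => ?_
    by_contra hiT
    exact hi (h0 x i fun h => hiT (hT h))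
  refine LipschitzWith.of_dist_le_mul fun x y => ?_
  rw [hsum x _ Finset.subset_union_left, hsum y (S x ∪ S y) Finset.subset_union_right,
    dist_eq_norm, ← Finset.sum_sub_distrib]
  have hcard : (S x ∪ S y).card ≤ 2 * m := by
    have := Finset.card_union_le (S x) (S y)
    have := hc x
    have := hc y
    omega
  calc ‖∑ i ∈ S x ∪ S y, (f i x - f i y)‖ ≤ ∑ i ∈ S x ∪ S y, K * dist x y :=
        norm_sum_le_of_le _ fun i _ => hK i x y
    _ = (S x ∪ S y).card * (K * dist x y) := by rw [Finset.sum_const, nsmul_eq_mul]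
    _ ≤ (2 * m : ℕ) * (K * dist x y) :=
        mul_le_mul_of_nonneg_right (by exact_mod_cast hcard) (by positivity)
    _ = _ := by push_cast; ring

/-- Multiplying a Lipschitz map vanishing at `0` by a cutoff function of support in a ball. -/
theorem norm_cutoff_smul_sub_le {X Z : Type*} [NormedAddCommGroup X] [NormedAddCommGroup Z]
    [NormedSpace ℝ Z] {ψ : X → ℝ} {u : X → Z} {a r : ℝ} (ha : 0 ≤ a)
    (hr : 0 ≤ r) (h1 : ∀ x, |ψ x| ≤ 1)
    (hψ : ∀ x y, |ψ x - ψ y| ≤ a * ‖x - y‖)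
    (h0 : ∀ x, r < ‖x‖ → ψ x = 0)
    (hu : ∀ x y, ‖u x - u y‖ ≤ ‖x - y‖) (hu0 : u 0 = 0) (x y : X) :
    ‖ψ x • u x - ψ y • u y‖ ≤ (a * r + 1) * ‖x - y‖ := by
  -- The increment of `ψ` should multiply `u` at the point of smaller norm: there `‖u x‖ ≤ r`,
  -- unless both products vanish.
  wlog hxy : ‖x‖ ≤ ‖y‖ generalizing x y
  · rw [norm_sub_rev, norm_sub_rev x]
    exact this y x (le_of_not_ge hxy)
  rcases lt_or_ge r ‖x‖ with hx | hx
  · have : ψ x • u x - ψ y • u y = 0 := by simp [h0 x hx, h0 y (hx.trans_le hxy)]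
    rw [this, norm_zero]
    positivity
  · have hux : ‖u x‖ ≤ r := by
      have := hu x 0
      rw [hu0, sub_zero, sub_zero] at this
      exact this.trans hx
    have : ψ x • u x - ψ y • u y = (ψ x - ψ y) • u x + ψ y • (u x - u y) := by
      rw [sub_smul, smul_sub]; abel
    rw [this]
    refine (norm_add_le _ _).trans ?_
    rw [norm_smul, norm_smul, Real.norm_eq_abs, Real.norm_eq_abs]
    have e1 := mul_le_mul (hψ x y) hux (norm_nonneg _) (by positivity)
    have e2 := mul_le_mul (h1 y) (hu x y) (norm_nonneg _) zero_le_one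
    linarith

/-- The piecewise linear function supported in `[1/2, 2]` whose dyadic dilations form a partition
of unity of the positive half-line. -/
def tent (t : ℝ) : ℝ := max 0 (min (2 * t - 1) (2 - t))

theorem abs_tent_le_one (t : ℝ) : |tent t| ≤ 1 := by
  rw [tent, abs_of_nonneg (le_max_left _ _)]
  refine max_le zero_le_one (min_le_iff.2 ?_)
  rcases le_total t 1 with h | h
  · left; linarith
  · right; linarith

theorem abs_tent_sub_le (s t : ℝ) : |tent s - tent t| ≤ 2 * |s - t| := by
  refine (abs_max_sub_max_le_max _ _ _ _).trans (max_le (by simp) ?_)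
  refine (abs_min_sub_min_le_max _ _ _ _).trans (max_le (le_of_eq ?_) ?_)
  · rw [← abs_two (α := ℝ), ← abs_mul]; congr 1; rw [abs_two]; ring
  · rw [sub_sub_sub_cancel_left, abs_sub_comm]
    linarith [abs_nonneg (s - t)]

theorem tent_of_le {t : ℝ} (h : t ≤ 1 / 2) : tent t = 0 :=
  max_eq_left ((min_le_left _ _).trans (by linarith))

theorem tent_of_ge {t : ℝ} (h : 2 ≤ t) : tent t = 0 :=
  max_eq_left ((min_le_right _ _).trans (by linarith))

theorem tent_add_tent_half {t : ℝ} (h : 1 ≤ t) (h' : t ≤ 2) : tent t + tent (t / 2) = 1 := by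
  rw [tent, tent, min_eq_right (by linarith), min_eq_left (by linarith), max_eq_right (by linarith),
    max_eq_right (by linarith)]
  ring

/-- If `2 ^ l ≤ t < 2 ^ (l + 1)`, then `t / 2 ^ k` is at least `2` for `k < l` and below `1 / 2` for
`k > l + 1`. At `t = 0` the logarithm is a default value, but every term vanishes. -/
theorem tent_zpow_eq_zero {t : ℝ} (ht : 0 ≤ t) {k : ℤ}
    (hk : k ∉ ({Int.log 2 t, Int.log 2 t + 1} : Finset ℤ)) : tent (t / 2 ^ k) = 0 := by
  simp only [Finset.mem_insert, Finset.mem_singleton, not_or] at hk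
  have h2 : (0 : ℝ) < 2 ^ k := by positivity
  rcases ht.eq_or_lt with rfl | ht
  · exact tent_of_le (by simp)
  have hl : (2 : ℝ) ^ Int.log 2 t ≤ t := by exact_mod_cast Int.zpow_log_le_self one_lt_two ht
  have hu : t < (2 : ℝ) ^ (Int.log 2 t + 1) := by
    exact_mod_cast Int.lt_zpow_succ_log_self one_lt_two t
  rcases lt_or_gt_of_ne hk.1 with h | h
  · refine tent_of_ge ((le_div_iff₀ h2).2 (le_trans ?_ hl))
    rw [mul_comm, ← zpow_add_one₀ two_ne_zero]
    exact zpow_le_zpow_right₀ one_le_two (by omega)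
  · refine tent_of_le ((div_le_iff₀ h2).2 (hu.le.trans ?_))
    have : (1 / 2 : ℝ) * 2 ^ k = 2 ^ (k - 1) := by
      rw [zpow_sub_one₀ two_ne_zero]; ring
    rw [this]
    exact zpow_le_zpow_right₀ one_le_two (by omega)

theorem sum_tent_zpow {t : ℝ} (ht : 0 < t) :
    ∑ k ∈ {Int.log 2 t, Int.log 2 t + 1}, tent (t / 2 ^ k) = 1 := by
  have hl : (2 : ℝ) ^ Int.log 2 t ≤ t := by exact_mod_cast Int.zpow_log_le_self one_lt_two ht
  have hu : t < (2 : ℝ) ^ (Int.log 2 t + 1) := by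
    exact_mod_cast Int.lt_zpow_succ_log_self one_lt_two t
  have h2 : (0 : ℝ) < 2 ^ Int.log 2 t := by positivity
  rw [zpow_add_one₀ two_ne_zero] at hu
  rw [Finset.sum_pair (by simp), zpow_add_one₀ two_ne_zero, ← div_div]
  exact tent_add_tent_half ((one_le_div h2).2 hl) ((div_le_iff₀ h2).2 (by linarith))

/-- The cutoff function equal to `1` on `[0, 1]` and to `0` on `[2, ∞)`. -/
def bump (t : ℝ) : ℝ := max 0 (min 1 (2 - t))

theorem abs_bump_le_one (t : ℝ) : |bump t| ≤ 1 := by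
  rw [bump, abs_of_nonneg (le_max_left _ _)]
  exact max_le zero_le_one (min_le_left _ _)

theorem abs_bump_sub_le (s t : ℝ) : |bump s - bump t| ≤ |s - t| := by
  refine (abs_max_sub_max_le_max _ _ _ _).trans (max_le (by simp) ?_)
  refine (abs_min_sub_min_le_max _ _ _ _).trans (max_le (by simp) ?_)
  rw [sub_sub_sub_cancel_left, abs_sub_comm]

theorem bump_of_le {t : ℝ} (h : t ≤ 1) : bump t = 1 := by
  rw [bump, min_eq_left (by linarith), max_eq_right zero_le_one]

theorem bump_of_ge {t : ℝ} (h : 2 ≤ t) : bump t = 0 :=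
  max_eq_left ((min_le_right _ _).trans (by linarith))

variable {X : Type*} [NormedAddCommGroup X] [NormedSpace ℝ X]

theorem norm_freeDelta_sub_le {M : Type*} [MetricSpace M] (x₀ x y : M) :
    ‖freeDelta x₀ x - freeDelta x₀ y‖ ≤ dist x y := by
  simpa [dist_eq_norm] using (lipschitzWith_freeDelta x₀).dist_le_mul x y

/-- A dilation followed by a translation, rescaled to be nonexpansive. -/
theorem norm_smul_freeDelta_sub_le {s : ℝ} (hs : 0 < s) (c : X) (x y : X) :
    ‖s • (freeDelta (0 : X) (c + s⁻¹ • x) - freeDelta 0 c) -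
      s • (freeDelta (0 : X) (c + s⁻¹ • y) - freeDelta 0 c)‖ ≤ ‖x - y‖ := by
  rw [← smul_sub, sub_sub_sub_cancel_right, norm_smul, Real.norm_of_nonneg hs.le]
  have h := norm_freeDelta_sub_le (0 : X) (c + s⁻¹ • x) (c + s⁻¹ • y)
  rw [dist_add_left, dist_eq_norm, ← smul_sub, norm_smul,
    Real.norm_of_nonneg (inv_pos.2 hs).le] at h
  calc _ ≤ s * (s⁻¹ * ‖x - y‖) := mul_le_mul_of_nonneg_left h hs.le
    _ = ‖x - y‖ := by rw [mul_inv_cancel_left₀ hs.ne']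

theorem norm_single_smul_freeDelta_sub_le {s : ℝ} (hs : 0 < s) (n : ℕ) (x y : X) :
    ‖L1Sum.single n (s⁻¹ • freeDelta (0 : X) (s • x)) -
      L1Sum.single n (s⁻¹ • freeDelta (0 : X) (s • y))‖ ≤ ‖x - y‖ := by
  rw [← map_sub, L1Sum.norm_single]
  simpa [freeDelta_base] using norm_smul_freeDelta_sub_le (inv_pos.2 hs) (0 : X) x y

/-- The map `F(X) → ℓ¹(F(X))` cutting out and rescaling countably many separated balls. -/
theorem exists_map_to_l1Sum (c : ℕ × ℤ → X) (hc : ∀ i j, i ≠ j → 4 ≤ ‖c i - c j‖)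
    (s : ℤ → ℝ) (hs : ∀ k, 0 < s k) :
    ∃ P : Free (0 : X) →L[ℝ] L1Sum (Free (0 : X)), ∀ n k (z : X), ‖z‖ ≤ 1 →
      P (freeDelta 0 (c (n, k) + z) - freeDelta 0 (c (n, k))) =
        L1Sum.single n ((s k)⁻¹ • freeDelta 0 (s k • z)) := by
  let u (i : ℕ × ℤ) (z : X) : L1Sum (Free (0 : X)) :=
    L1Sum.single i.1 ((s i.2)⁻¹ • freeDelta (0 : X) (s i.2 • z))
  let g (i : ℕ × ℤ) (x : X) : L1Sum (Free (0 : X)) := bump ‖x - c i‖ • u i (x - c i)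
  have hu0 (i) : u i 0 = 0 := by simp [u, freeDelta_base]
  -- The constant is `a * r + 1` with `a = 1`, `r = 2`, independent of the scales `s`.
  have hg (i x y) : ‖g i x - g i y‖ ≤ (3 : ℝ≥0) * dist x y := by
    have := norm_cutoff_smul_sub_le (ψ := fun z : X => bump ‖z‖) (u := u i) (a := 1) (r := 2)
      zero_le_one zero_le_two (fun _ => abs_bump_le_one _)
      (fun x y => by
        rw [one_mul]; exact (abs_bump_sub_le _ _).trans (abs_norm_sub_norm_le x y))
      (fun x hx => bump_of_ge hx.le)
      (norm_single_smul_freeDelta_sub_le (hs i.2) i.1) (hu0 i) (x - c i) (y - c i)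
    rw [sub_sub_sub_cancel_right] at this
    rw [dist_eq_norm]
    refine this.trans (le_of_eq ?_)
    norm_num
  -- Open balls of radius `2` around `4`-separated centres are disjoint, so at most one term is
  -- nonzero at each point.
  have hfar {i : ℕ × ℤ} {x : X} (hx : ‖x - c i‖ < 2) {j : ℕ × ℤ} (hj : j ≠ i) : g j x = 0 := by
    have h1 := hc j i hj
    have h2 : ‖c j - c i‖ ≤ ‖x - c i‖ + ‖x - c j‖ := by
      have := norm_sub_le (x - c i) (x - c j)
      rwa [sub_sub_sub_cancel_left] at this
    have : g j x = bump ‖x - c j‖ • u j (x - c j) := rfl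
    rw [this, bump_of_ge (by linarith), zero_smul]
  have hS (x : X) : ∃ S : Finset (ℕ × ℤ), S.card ≤ 1 ∧ ∀ i ∉ S, g i x = 0 := by
    by_cases h : ∃ i, ‖x - c i‖ < 2
    · obtain ⟨i, hi⟩ := h
      exact ⟨{i}, by simp, fun j hj => hfar hi (by simpa using hj)⟩
    · push Not at h
      refine ⟨∅, by simp, fun i _ => ?_⟩
      have : g i x = bump ‖x - c i‖ • u i (x - c i) := rfl
      rw [this, bump_of_ge (h i), zero_smul]
  obtain ⟨P, hP, -⟩ := Free.exists_lift (0 : X) (lipschitzWith_finsum 1 hg hS)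
  have hval (i : ℕ × ℤ) (z : X) (hz : ‖z‖ ≤ 1) : ∑ᶠ j, g j (c i + z) = u i z := by
    have hz' : c i + z - c i = z := add_sub_cancel_left _ _
    rw [finsum_eq_single _ i fun j hj => hfar (by rw [hz']; linarith) hj]
    change bump ‖c i + z - c i‖ • u i (c i + z - c i) = u i z
    rw [hz', bump_of_le hz, one_smul]
  refine ⟨P, fun n k z hz => ?_⟩
  have h0 := hval (n, k) 0 (by simp)
  rw [add_zero, hu0] at h0
  rw [map_sub, hP, hP, sub_sub_sub_cancel_right, hval (n, k) z hz, h0, sub_zero]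

/-- The map `ℓ¹(F(X)) → F(X)` distributing dyadic annuli among translated unit balls. -/
theorem exists_map_from_l1Sum (c : ℕ × ℤ → X) :
    ∃ I : L1Sum (Free (0 : X)) →L[ℝ] Free (0 : X), ∀ n x,
      I (L1Sum.single n (freeDelta 0 x)) =
        ∑ k ∈ {Int.log 2 ‖x‖, Int.log 2 ‖x‖ + 1}, tent (‖x‖ / 2 ^ k) • (2 * 2 ^ k : ℝ) •
          (freeDelta 0 (c (n, k) + (2 * 2 ^ k : ℝ)⁻¹ • x) - freeDelta 0 (c (n, k))) := by
  let u (n : ℕ) (k : ℤ) (x : X) : Free (0 : X) := (2 * 2 ^ k : ℝ) •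
    (freeDelta 0 (c (n, k) + (2 * 2 ^ k : ℝ)⁻¹ • x) - freeDelta 0 (c (n, k)))
  let f (n : ℕ) (k : ℤ) (x : X) : Free (0 : X) := tent (‖x‖ / 2 ^ k) • u n k x
  have hu0 (n k) : u n k 0 = 0 := by simp [u]
  -- `a * r + 1 = (2 / 2 ^ k) * (2 * 2 ^ k) + 1 = 5`: the steepness of the cutoff cancels the size
  -- of its support.
  have hf (n k x y) : ‖f n k x - f n k y‖ ≤ (5 : ℝ≥0) * dist x y := by
    have h2 : (0 : ℝ) < 2 ^ k := by positivity
    have := norm_cutoff_smul_sub_le (ψ := fun z : X => tent (‖z‖ / 2 ^ k)) (u := u n k)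
      (a := 2 / 2 ^ k) (r := 2 * 2 ^ k) (by positivity) (by positivity) (fun _ => abs_tent_le_one _)
      (fun x y => by
        refine (abs_tent_sub_le _ _).trans ?_
        rw [← sub_div, abs_div, abs_of_pos h2, div_mul_eq_mul_div, mul_div_assoc]
        gcongr
        exact abs_norm_sub_norm_le x y)
      (fun x hx => tent_of_ge ((le_div_iff₀ h2).2 hx.le))
      (norm_smul_freeDelta_sub_le (by positivity) (c (n, k))) (hu0 n k) x y
    rw [dist_eq_norm]
    refine this.trans (le_of_eq ?_)
    rw [div_mul_eq_mul_div, mul_left_comm, mul_div_assoc, mul_div_cancel_right₀ _ h2.ne']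
    norm_num
  have hzero (n : ℕ) (x : X) (k : ℤ) (hk : k ∉ ({Int.log 2 ‖x‖, Int.log 2 ‖x‖ + 1} : Finset ℤ)) :
      f n k x = 0 := by
    change tent (‖x‖ / 2 ^ k) • u n k x = 0
    rw [tent_zpow_eq_zero (norm_nonneg x) hk, zero_smul]
  have hlift (n : ℕ) := Free.exists_lift (0 : X) (lipschitzWith_finsum 2 (hf n)
    fun x => ⟨_, Finset.card_le_two, hzero n x⟩)
  choose T hT hTn using hlift
  obtain ⟨I, hI⟩ := L1Sum.exists_lift T hTn
  refine ⟨I, fun n x => ?_⟩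
  have h0 : ∑ᶠ k, f n k 0 = 0 := by
    simp [f, hu0]
  rw [hI, hT, h0, sub_zero]
  refine finsum_eq_sum_of_support_subset _ fun k hk => ?_
  by_contra hk'
  exact hk (hzero n x k hk')

theorem exists_separated [Nontrivial X] :
    ∃ c : ℕ × ℤ → X, ∀ i j, i ≠ j → 4 ≤ ‖c i - c j‖ := by
  obtain ⟨e, he⟩ := exists_norm_eq X (zero_le_one' ℝ)
  refine ⟨fun i => (4 * Encodable.encode i : ℝ) • e, fun i j hij => ?_⟩
  rw [← sub_smul, norm_smul, he, mul_one, ← mul_sub, norm_mul, Real.norm_ofNat]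
  have h : (Encodable.encode i : ℤ) - Encodable.encode j ≠ 0 := by
    rw [sub_ne_zero]
    exact_mod_cast fun h => hij (Encodable.encode_injective h)
  have h1 : (1 : ℝ) ≤ |(Encodable.encode i : ℝ) - Encodable.encode j| := by
    exact_mod_cast Int.one_le_abs h
  rw [Real.norm_eq_abs]
  linarith

/-- The `ℓ¹`-sum of countably many copies of the free space of a normed space is isomorphic to a
complemented subspace of that free space. -/
theorem isComplementedIn_l1Sum_free [Nontrivial X] :
    IsComplementedIn (L1Sum (Free (0 : X))) (Free (0 : X)) := by
  obtain ⟨c, hc⟩ := exists_separated (X := X)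
  obtain ⟨P, hP⟩ := exists_map_to_l1Sum c hc (fun k => 2 * 2 ^ k) fun k => by positivity
  obtain ⟨I, hI⟩ := exists_map_from_l1Sum c
  have hPI (n : ℕ) : (P.comp I).comp (L1Sum.single n) = L1Sum.single n := by
    refine Free.hom_ext fun x => ?_
    change P (I (L1Sum.single n (freeDelta 0 x))) = _
    rcases eq_or_ne x 0 with rfl | hx
    · rw [freeDelta_base, map_zero, map_zero, map_zero]
    rw [hI, map_sum]
    -- Where the tent is nonzero, `‖x‖ < 2 * 2 ^ k`, so the rescaled point lies in the unit ball on
    -- which `P` inverts the rescaling.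
    have hterm (k : ℤ) : P (tent (‖x‖ / 2 ^ k) • (2 * 2 ^ k : ℝ) •
        (freeDelta 0 (c (n, k) + (2 * 2 ^ k : ℝ)⁻¹ • x) - freeDelta 0 (c (n, k)))) =
        tent (‖x‖ / 2 ^ k) • L1Sum.single n (freeDelta 0 x) := by
      have h2 : (0 : ℝ) < 2 ^ k := by positivity
      have h2' : (2 * 2 ^ k : ℝ) ≠ 0 := by positivity
      rcases le_or_gt (2 : ℝ) (‖x‖ / 2 ^ k) with h | h
      · rw [tent_of_ge h, zero_smul, zero_smul, map_zero]
      · rw [div_lt_iff₀ h2] at h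
        rw [map_smul, map_smul, hP n k _ (by
          rw [norm_smul, norm_inv, Real.norm_of_nonneg (by positivity), inv_mul_le_iff₀
            (by positivity), mul_one]
          exact h.le), smul_inv_smul₀ h2', map_smul, smul_inv_smul₀ h2']
    rw [Finset.sum_congr rfl fun k _ => hterm k, ← Finset.sum_smul,
      sum_tent_zpow (norm_pos_iff.2 hx), one_smul]
  have h : P.comp I = ContinuousLinearMap.id ℝ _ :=
    L1Sum.hom_ext fun n μ => DFunLike.congr_fun (hPI n) μ
  exact ⟨I, P, fun b => DFunLike.congr_fun h b⟩

end Geometry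

theorem subsingleton_freeSpace {M : Type*} [MetricSpace M] [Subsingleton M] (x₀ : M) :
    Subsingleton (FreeSpace M x₀) := by
  refine ⟨fun μ ν => Subtype.ext (ContinuousLinearMap.ext fun f => ?_)⟩
  have hf : f = 0 := Subtype.ext (funext fun x => by
    rw [Subsingleton.elim x x₀]; exact f.base_apply)
  rw [hf, map_zero, map_zero]

end LipFree

end

/-! ### Conclusion -/

theorem corollary3p2
    {X : Type*} [NormedAddCommGroup X] [NormedSpace ℝ X] [CompleteSpace X]
    {M : Type*} [MetricSpace M]
    (N₁ : Set X) (N₂ : Set M)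
    (hN₁ : LipFree.IsLipschitzRetract N₁) (hN₂ : LipFree.IsLipschitzRetract N₂)
    (hX : LipFree.LipschitzEquivalent X N₂) (hM : LipFree.LipschitzEquivalent M N₁)
    (x₀ : X) (m₀ : M) :
    Nonempty (LipFree.FreeSpace X x₀ ≃L[ℝ] LipFree.FreeSpace M m₀) := by
  obtain ⟨r₁, ⟨K₁, hr₁⟩, hr₁'⟩ := hN₁
  obtain ⟨r₂, ⟨K₂, hr₂⟩, hr₂'⟩ := hN₂
  obtain ⟨φ, ⟨A, hφ⟩, ⟨B, hφ'⟩⟩ := hX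
  obtain ⟨χ, ⟨C, hχ⟩, ⟨D, hχ'⟩⟩ := hM
  -- A one-point `X` has no separated sequence; then `M` has at most one point and both free spaces
  -- are zero.
  rcases subsingleton_or_nontrivial X with hX | hX
  · have : Subsingleton M := (Subtype.val_injective.comp χ.injective).subsingleton
    have := LipFree.subsingleton_freeSpace x₀
    have := LipFree.subsingleton_freeSpace m₀
    exact ⟨.equivOfInverse 0 0 (fun _ => Subsingleton.elim _ _) fun _ => Subsingleton.elim _ _⟩
  have hMX (x : X) : LipFree.IsComplementedIn (LipFree.Free m₀) (LipFree.Free x) :=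
    .of_lipschitz_retraction m₀ x ((LipschitzWith.subtype_val N₁).comp hχ) (hχ'.comp hr₁)
      fun y => by simp [hr₁']
  have hXM (x : X) : LipFree.IsComplementedIn (LipFree.Free x) (LipFree.Free m₀) :=
    .of_lipschitz_retraction x m₀ ((LipschitzWith.subtype_val N₂).comp hφ) (hφ'.comp hr₂)
      fun y => by simp [hr₂']
  have hXX (x y : X) : LipFree.IsComplementedIn (LipFree.Free x) (LipFree.Free y) :=
    .of_lipschitz_retraction x y LipschitzWith.id LipschitzWith.id fun _ => rfl
  have hl := LipFree.isComplementedIn_l1Sum_free (X := X)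
  obtain ⟨e⟩ := (hXX x₀ 0).nonempty_equiv_l1Sum (hl.trans (hXX 0 x₀))
  obtain ⟨e'⟩ := (hMX 0).nonempty_equiv_l1Sum (hl.trans (hXM 0))
  exact ⟨(LipFree.freeEquiv x₀).symm.trans <| (e.trans e'.symm).trans (LipFree.freeEquiv m₀)⟩
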